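/- Let $T,d\in\mathbb N$, let $(\Omega,\mathcal F,(\mathcal F_t)_{t=0,\dots,T},P)$ be a filtered probability space, let $S=(S^1,\dots,S^d)$ be an adapted real-valued price process of $d$ non-shortable stocks, let $r=(r_t)_{t=1,\dots,T}$ be a nonnegative adapted process of interest rates ($r_t$ is the rate between $t-1$ and $t$), and let $\alpha\in[0,1)$ be a tax rate. (In)equalities between random variables hold a.s. *Strategies and wealth.* A strategy $N\in\mathcal N$ consists of $N_{i,t,j}\in L^0(\mathcal F_t;\mathbb R_+)$, the number of shares of stock $j$ bought at time $i$ and still held after trading at time $t\ge i$, with $N_{i,i,j}\ge N_{i,i+1,j}\ge\dots\ge N_{i,T,j}=0$ for $i=0,\dots,T-1$ (and $N_{T,T,j}:=0$); write $N_{i,t}=(N_{i,t,1},\dots,N_{i,t,d})$. For initial capital $x\in\mathbb R$ the bank account $\eta$ is determined by $\eta_{-1}=x$ and $$\eta_t-\eta_{t-1}=r_t\eta_{t-1}1_{(t\ge1)}+\Big\langle\sum_{i=0}^{t-1}(N_{i,t-1}-N_{i,t})-N_{t,t},S_t\Big\rangle-(\Pi_t-\Pi_{t-1})1_{(t\ge1)},\quad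 t=0,\dots,T,$$ where $\Pi_t=\alpha\max_{u=0,\dots,t}G_u$, $G_0=0$ and $G_t=\sum_{u=1}^t\big(\eta_{u-1}r_u+\sum_{i=0}^{u-1}\langle N_{i,u-1}-N_{i,u},S_u-S_i\rangle\big)$. The terminal wealth is $V^\alpha(x,N):=\eta_T$. The model satisfies no-arbitrage (NA) if, for every $N\in\mathcal N$, $V^\alpha(0,N)\ge0$ a.s. implies $V^\alpha(0,N)=0$ a.s. Let $$\mathcal V^\alpha(x):=\{V^\alpha(x,N):N\in\mathcal N\}-L^0(\mathcal F_T;\mathbb R_+),$$ $$\mathcal R_t:=\{\beta\in L^0(\mathcal F_t;\mathbb R^d_+):\langle\beta,S_{t+1}-(1+r_{t+1})S_t\rangle=0\ \text{a.s.}\},\quad t=0,\dots,T-1.$$ *NUIBR.* A reaction function is a map $R=(R_{i,t,j})_{0\le i\le t\le T-1,\,1\le j\le d}:\Omega\times\mathbb R_+^{T(T+1)d/2}\to\mathbb R_+^{T(T+1)d/2}$ with $R_{i,t,j}\ge R_{i,t+1,j}$ such that $R_{i,t,j}$ is measurable with respect to the $\sigma$-algebra generated by $\mathcal F_t$ and the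 coordinates $(i',s,j')$ with $s\le t$. It maps $N\in\mathcal N$ to the strategy $R(N)\in\mathcal N$ with $R_{i,t,j}(N)(\omega)=R_{i,t,j}(\omega,N(\omega))$ for $t\le T-1$ and value $0$ at $t=T$. The model satisfies *no unbounded non-substitutable investment with bounded risk* (NUIBR) if for every $x\in\mathbb R$ there is a reaction function $R$ with $V^\alpha(x,R(N))\ge V^\alpha(x,N)$ a.s. for all $N\in\mathcal N$ such that for all $K\in\mathbb R_+$ the set $$\mathrm{conv}\Big\{\max_{i=0,\dots,T-1,\ j=1,\dots,d}R_{i,i,j}(N)\ :\ N\in\mathcal N,\ V^\alpha(x,N)\ge-K\ \text{a.s.}\Big\}$$ is bounded in $L^0$. **Corollary.** Suppose that the model satisfies NA and that there are no redundant stocks, i.e. $\mathcal R_t=\{0\}$ for all $t=0,\dots,T-1$. Then the model satisfies NUIBR; more precisely, there is a reaction function acting as the identity, $R(N)=N$ a.s. for all $N\in\mathcal N$, that has the properties required in NUIBR for every $x\in\mathbb R$. Moreover, for every $x\in\mathbb R$, the set $\mathcal V^\alpha(x)$ is closed with respect to convergence in probability. (Neither $S\ge0$ nor boundedness of the interest rates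 is assumed.) -/

import Mathlib

open MeasureTheory Filter Topology
open scoped NNReal ENNReal

/-- A market with terminal time `T`, `d` non-shortable stocks, a bank account and a tax rate
`α ∈ [0,1)`.  Only the times `0, …, T` of the filtration and of the prices, and only the interest
rates `r 1, …, r T`, are ever used (`r t` is the rate between `t - 1` and `t`). -/
structure TaxMarket (Ω : Type*) [m : MeasurableSpace Ω] (P : Measure Ω) (d T : ℕ) where
  /-- the information flow -/
  𝓕 : Filtration ℕ m
  /-- the stock prices -/
  S : ℕ → Ω → Fin d → ℝ
  /-- the interest rates -/
  r : ℕ → Ω → ℝ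
  /-- the tax rate -/
  α : ℝ
  measurable_S : ∀ t, t ≤ T → Measurable[𝓕 t] (S t)
  measurable_r : ∀ t, 1 ≤ t → t ≤ T → Measurable[𝓕 t] (r t)
  r_nonneg : ∀ t, 1 ≤ t → t ≤ T → ∀ᵐ ω ∂P, 0 ≤ r t ω
  α_nonneg : 0 ≤ α
  α_lt_one : α < 1

/-- `N i t ω j` is the number of shares of stock `j` that are bought at time `i` and still held
after trading at time `t`.  Only the entries with `i ≤ t ≤ T` are meaningful. -/
abbrev Holdings (Ω : Type*) (d : ℕ) : Type _ := ℕ → ℕ → Ω → Fin d → ℝ≥0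

/-- The index set of the triples `(i, t, j)` with `0 ≤ i ≤ t ≤ T - 1` and `j` a stock. -/
abbrev TradeIndex (d T : ℕ) : Type := {p : Fin T × Fin T // p.1 ≤ p.2} × Fin d

/-- The bundle of all numbers `N i t ω j`, `i ≤ t ≤ T - 1`, in the state `ω`. -/
def Holdings.actions {Ω : Type*} {d : ℕ} (T : ℕ) (N : Holdings Ω d) (ω : Ω) :
    TradeIndex d T → ℝ≥0 :=
  fun k => N k.1.1.1 k.1.1.2 ω k.2

/-- The maximal purchase `max_{i ≤ T - 1, j} N i i ω j` (equal to `0` if there is no index). -/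
noncomputable def Holdings.maxPurchase {Ω : Type*} {d : ℕ} (T : ℕ) (N : Holdings Ω d) (ω : Ω) :
    ℝ :=
  ((Finset.univ.sup fun p : Fin T × Fin d => N p.1 p.1 ω p.2 : ℝ≥0) : ℝ)

/-- A set of real random variables is bounded in `L⁰`. -/
def BoundedInL0 {Ω : Type*} [MeasurableSpace Ω] (P : Measure Ω) (A : Set (Ω → ℝ)) : Prop :=
  Tendsto (fun a : ℝ => ⨆ X ∈ A, P {ω | a < |X ω|}) atTop (𝓝 0)

/-- A set of real random variables (closed under modification on null sets) is closed with respect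
to convergence in probability. -/
def ClosedInProbability {Ω : Type*} [MeasurableSpace Ω] (P : Measure Ω) (A : Set (Ω → ℝ)) : Prop :=
  ∀ (X : ℕ → Ω → ℝ) (f : Ω → ℝ), (∀ n, X n ∈ A) → TendstoInMeasure P X atTop f → f ∈ A

namespace TaxMarket

variable {Ω : Type*} [m : MeasurableSpace Ω] {P : Measure Ω} {d T : ℕ} (M : TaxMarket Ω P d T)

/-- The set of all trading strategies.  The requirement at `t = T` is forced liquidation
(for `i = T`: nothing is bought at time `T`). -/
def strategies : Set (Holdings Ω d) :=
  {N | (∀ i t, i ≤ t → t ≤ T → Measurable[M.𝓕 t] (N i t)) ∧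
    (∀ i t, i ≤ t → t < T → ∀ᵐ ω ∂P, ∀ j, N i (t + 1) ω j ≤ N i t ω j) ∧
    (∀ i, i ≤ T → ∀ᵐ ω ∂P, ∀ j, N i T ω j = 0)}

/-- The gains realized by stock sales at time `t`:
`∑_{i<t} ⟨N_{i,t-1} - N_{i,t}, S_t - S_i⟩`. -/
noncomputable def realizedStockGain (N : Holdings Ω d) (t : ℕ) (ω : Ω) : ℝ :=
  ∑ i ∈ Finset.range t, ∑ j, ((N i (t - 1) ω j : ℝ) - N i t ω j) * (M.S t ω j - M.S i ω j)

/-- The cash flow of the stock trades at time `t`: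
`⟨∑_{i<t} (N_{i,t-1} - N_{i,t}) - N_{t,t}, S_t⟩`. -/
noncomputable def tradingCashFlow (N : Holdings Ω d) (t : ℕ) (ω : Ω) : ℝ :=
  ∑ j, ((∑ i ∈ Finset.range t, ((N i (t - 1) ω j : ℝ) - N i t ω j)) - N t t ω j) * M.S t ω j

/-- The triple `(η_t, G_t, max_{u ≤ t} G_u)` of the bank account after trading and paying taxes,
the accumulated realized profits and losses, and their running maximum, for the self-financing
strategy with initial capital `x` and stock holdings `N`. -/
noncomputable def account (x : ℝ) (N : Holdings Ω d) : ℕ → Ω → ℝ × ℝ × ℝ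
  | 0, ω => (x + M.tradingCashFlow N 0 ω, 0, 0)
  | t + 1, ω =>
    let η := (account x N t ω).1
    let G := (account x N t ω).2.1
    let mx := (account x N t ω).2.2
    let G' := G + (η * M.r (t + 1) ω + M.realizedStockGain N (t + 1) ω)
    let mx' := max mx G'
    (η + M.r (t + 1) ω * η + M.tradingCashFlow N (t + 1) ω - (M.α * mx' - M.α * mx), G', mx')

/-- The bank account `η_t` after paying taxes and trading at time `t`. -/
noncomputable def bank (x : ℝ) (N : Holdings Ω d) (t : ℕ) (ω : Ω) : ℝ := (M.account x N t ω).1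

/-- The accumulated realized profits and losses `G_t`. -/
noncomputable def gains (x : ℝ) (N : Holdings Ω d) (t : ℕ) (ω : Ω) : ℝ := (M.account x N t ω).2.1

/-- The accumulated tax payments with limited use of losses, `Π_t = α max_{u ≤ t} G_u`. -/
noncomputable def taxes (x : ℝ) (N : Holdings Ω d) (t : ℕ) (ω : Ω) : ℝ :=
  M.α * (Finset.range (t + 1)).sup' Finset.nonempty_range_add_one fun u => M.gains x N u ω

theorem gains_eq (x : ℝ) (N : Holdings Ω d) (t : ℕ) (ω : Ω) :
    M.gains x N t ω = ∑ u ∈ Finset.Icc 1 t,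
      (M.bank x N (u - 1) ω * M.r u ω + M.realizedStockGain N u ω) := by
  induction t with
  | zero => simp [gains, account]
  | succ t ih =>
    rw [Finset.sum_Icc_succ_top (by omega), ← ih]
    simp [gains, bank, account]

theorem account_max_eq (x : ℝ) (N : Holdings Ω d) (t : ℕ) (ω : Ω) :
    M.α * (M.account x N t ω).2.2 = M.taxes x N t ω := by
  unfold taxes
  congr 1
  induction t with
  | zero => simp [gains, account]
  | succ t ih =>
    have h : (M.account x N (t + 1) ω).2.2
        = max (M.account x N t ω).2.2 (M.gains x N (t + 1) ω) := rfl
    rw [h, ih, max_comm]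
    simp only [Finset.range_add_one (n := t + 1)]
    rw [Finset.sup'_insert]

theorem bank_zero (x : ℝ) (N : Holdings Ω d) (ω : Ω) :
    M.bank x N 0 ω - x = M.tradingCashFlow N 0 ω := by
  simp [bank, account]

theorem bank_succ (x : ℝ) (N : Holdings Ω d) (t : ℕ) (ω : Ω) :
    M.bank x N (t + 1) ω - M.bank x N t ω = M.r (t + 1) ω * M.bank x N t ω
      + M.tradingCashFlow N (t + 1) ω - (M.taxes x N (t + 1) ω - M.taxes x N t ω) := by
  rw [← account_max_eq, ← account_max_eq]
  simp only [bank, account]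
  ring

/-- The terminal wealth `V^α(x, N) = η_T`. -/
noncomputable def terminalWealth (x : ℝ) (N : Holdings Ω d) (ω : Ω) : ℝ := M.bank x N T ω

/-- The no-arbitrage condition. -/
def NoArbitrage : Prop :=
  ∀ N ∈ M.strategies, (∀ᵐ ω ∂P, 0 ≤ M.terminalWealth 0 N ω) →
    ∀ᵐ ω ∂P, M.terminalWealth 0 N ω = 0

/-- The cone of reversible strategies at time `t`. -/
def reversible (t : ℕ) : Set (Ω → Fin d → ℝ≥0) :=
  {β | Measurable[M.𝓕 t] β ∧
    ∀ᵐ ω ∂P, ∑ j, (β ω j : ℝ) * (M.S (t + 1) ω j - (1 + M.r (t + 1) ω) * M.S t ω j) = 0}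

/-- There are no redundant stocks: each cone of reversible strategies is `{0}` (up to null sets). -/
def NoRedundantStocks : Prop :=
  ∀ t, t < T → ∀ β ∈ M.reversible t, β =ᵐ[P] 0

/-- The σ-algebra on `Ω × ℝ₊^{T(T+1)d/2}` generated by the information at time `t` and the
coordinates `(i, s, j)` with `s ≤ t`. -/
abbrev actionSigma (t : ℕ) : MeasurableSpace (Ω × (TradeIndex d T → ℝ≥0)) :=
  (M.𝓕 t).comap Prod.fst ⊔
    ⨆ (k : TradeIndex d T) (_ : (k.1.1.2 : ℕ) ≤ t),
      (borel ℝ≥0).comap fun p : Ω × (TradeIndex d T → ℝ≥0) => p.2 k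

/-- A reaction function: the component `(i, t, j)` depends only on the information at time `t` and
on the actions up to time `t`, and the components are nonincreasing in `t`. -/
structure ReactionFunction where
  /-- the underlying map -/
  toFun : Ω × (TradeIndex d T → ℝ≥0) → TradeIndex d T → ℝ≥0
  measurable_toFun : ∀ k : TradeIndex d T,
    Measurable[M.actionSigma k.1.1.2] fun p => toFun p k
  antitone_toFun : ∀ (p : Ω × (TradeIndex d T → ℝ≥0)) (i t s : Fin T) (j : Fin d)
    (hit : i ≤ t) (hts : t ≤ s),
    toFun p (⟨(i, s), hit.trans hts⟩, j) ≤ toFun p (⟨(i, t), hit⟩, j)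

variable {M} in
/-- The strategy `R(N)` that the reaction function `R` plays in response to `N`. -/
def ReactionFunction.apply (R : M.ReactionFunction) (N : Holdings Ω d) : Holdings Ω d :=
  fun i t ω j =>
    if h : i ≤ t ∧ t < T then
      R.toFun (ω, N.actions T ω) (⟨(⟨i, h.1.trans_lt h.2⟩, ⟨t, h.2⟩), h.1⟩, j)
    else 0

variable {M} in
/-- `R` reacts to a strategy with the strategy itself. -/
def ReactionFunction.IsIdentity (R : M.ReactionFunction) : Prop :=
  ∀ N ∈ M.strategies, ∀ i t, i ≤ t → t ≤ T → R.apply N i t =ᵐ[P] N i t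

/-- `R` is a reaction function as required in the condition NUIBR for the initial capital `x`. -/
def IsNUIBRReaction (x : ℝ) (R : M.ReactionFunction) : Prop :=
  (∀ N ∈ M.strategies,
    ∀ᵐ ω ∂P, M.terminalWealth x N ω ≤ M.terminalWealth x (R.apply N) ω) ∧
  ∀ K : ℝ, 0 ≤ K → BoundedInL0 P (convexHull ℝ
    {X | ∃ N ∈ M.strategies, (∀ᵐ ω ∂P, -K ≤ M.terminalWealth x N ω) ∧
      X = (R.apply N).maxPurchase T})

/-- No unbounded non-substitutable investment with bounded risk. -/
def NUIBR : Prop := ∀ x : ℝ, ∃ R : M.ReactionFunction, M.IsNUIBRReaction x R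

/-- The set `{V^α(x, N) : N a strategy} - L⁰(𝓕_T; ℝ₊)`. -/
def attainable (x : ℝ) : Set (Ω → ℝ) :=
  {f | ∃ N ∈ M.strategies, ∃ μ : Ω → ℝ≥0, Measurable[M.𝓕 T] μ ∧
    f =ᵐ[P] fun ω => M.terminalWealth x N ω - μ ω}

end TaxMarket

/-! ### Measurable random subsequences -/

section RandomSubsequences

/-! The after-tax model is compared with a market without taxes. Tax increments are nonnegative,
being `α ≥ 0` times increments of a running maximum, and interest rates are nonnegative. So the
after-tax wealth is at most what the same positions earn untaxed, namely the compounding factor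
times `x` plus the long-only gains in discounted excess returns (`wealth_le`). A lower bound on
terminal wealth is thus a lower bound on gains that are linear in the positions.

Conversely, the comparison market inherits the hypotheses one period at a time. Of a one-period gain
`Y ≥ 0` at least `(1 - α) Y` survives until the end, so NA forces `Y = 0`; the position is then
reversible, hence zero (`onePeriodRisky_excessReturn`).

The core is `OnePeriodRisky.bddAbove_of_bddBelow`: long-only strategies with gains bounded below
state by state are bounded state by state. Were the first position unbounded on a non-null event,
dividing by its size and passing to a random subsequential limit would give a strategy with
nonnegative gain and a first position of total size one there, which is impossible.

Boundedness in L⁰ follows because dominance by such positions is a convex condition. Closedness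
follows because holdings of a convergent sequence of wealths are bounded state by state, so they
have adapted subsequential limits, and the account is continuous in the holdings. -/

theorem Measurable.eval_random_index {Ω β : Type*} {mΩ : MeasurableSpace Ω} [MeasurableSpace β]
    {f : ℕ → Ω → β} {τ : Ω → ℕ} (hf : ∀ n, Measurable (f n)) (hτ : Measurable τ) :
    Measurable fun ω => f (τ ω) ω :=
  (measurable_from_prod_countable_right (f := fun p : ℕ × Ω => f p.1 p.2) hf).comp
    (hτ.prodMk measurable_id)

/-- If the measurable events `E k 0, E k 1, …` occur infinitely often, for every `k`, then there
is a measurable random subsequence `τ 0 < τ 1 < …` such that `E k (τ k)` occurs for every `k`. -/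
theorem exists_measurable_strictMono_mem {Ω : Type*} {mΩ : MeasurableSpace Ω}
    (E : ℕ → ℕ → Set Ω) (hE : ∀ k n, MeasurableSet (E k n))
    (hfreq : ∀ k ω, ∃ᶠ n in atTop, ω ∈ E k n) :
    ∃ τ : ℕ → Ω → ℕ, (∀ k, Measurable (τ k)) ∧ (∀ ω, StrictMono fun k => τ k ω) ∧
      ∀ k ω, ω ∈ E k (τ k ω) := by
  classical
  have next : ∀ (k : ℕ) (σ : {σ : Ω → ℕ // Measurable σ}), ∃ σ' : {σ : Ω → ℕ // Measurable σ},
      ∀ ω, σ.1 ω < σ'.1 ω ∧ ω ∈ E k (σ'.1 ω) := by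
    rintro k ⟨σ, hσ⟩
    have hex : ∀ ω, ∃ n, σ ω < n ∧ ω ∈ E k n := fun ω =>
      let ⟨n, hn, h⟩ := (frequently_atTop.1 (hfreq k ω)) (σ ω + 1)
      ⟨n, hn, h⟩
    refine ⟨⟨fun ω => Nat.find (hex ω), measurable_find hex fun n => ?_⟩,
      fun ω => Nat.find_spec (hex ω)⟩
    exact (measurableSet_lt hσ measurable_const).inter (hE k n)
  choose nx hnx using next
  let τ : ℕ → {σ : Ω → ℕ // Measurable σ} :=
    fun k => Nat.rec (nx 0 ⟨fun _ => 0, measurable_const⟩) (fun k σ => nx (k + 1) σ) k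
  refine ⟨fun k => (τ k).1, fun k => (τ k).2,
    fun ω => strictMono_nat_of_lt_succ fun k => (hnx (k + 1) (τ k) ω).1, fun k ω => ?_⟩
  cases k with
  | zero => exact (hnx 0 _ ω).2
  | succ k => exact (hnx (k + 1) (τ k) ω).2

/-- Every sequence of `[0, ∞]`-valued random variables has a measurable random subsequence that
converges pointwise. -/
theorem exists_measurable_strictMono_tendsto {Ω : Type*} {mΩ : MeasurableSpace Ω}
    (ξ : ℕ → Ω → ℝ≥0∞) (hξ : ∀ n, Measurable (ξ n)) :
    ∃ τ : ℕ → Ω → ℕ, (∀ k, Measurable (τ k)) ∧ (∀ ω, StrictMono fun k => τ k ω) ∧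
      ∃ L : Ω → ℝ≥0∞, Measurable L ∧ ∀ ω, Tendsto (fun k => ξ (τ k ω) ω) atTop (𝓝 (L ω)) := by
  let L : Ω → ℝ≥0∞ := fun ω => liminf (fun n => ξ n ω) atTop
  have hL : Measurable L := Measurable.liminf hξ
  obtain ⟨τ, hτ, hmono, hmem⟩ := exists_measurable_strictMono_mem
    -- Staying within `1/(k+1)` above the liminf bounds the limsup along `τ` by `L`. Where `L = ∞`
    -- the event is everything, and the liminf bound alone gives convergence.
    (fun k n => {ω | ξ n ω ≤ L ω + ((k : ℝ≥0∞) + 1)⁻¹})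
    (fun k n => measurableSet_le (hξ n) (hL.add_const _)) fun k ω => by
      by_cases h : L ω = ∞
      · exact (Eventually.of_forall fun n => by simp [h]).frequently
      · have hlt : liminf (fun n => ξ n ω) atTop < L ω + ((k : ℝ≥0∞) + 1)⁻¹ :=
          ENNReal.lt_add_right h (by simp)
        exact (frequently_lt_of_liminf_lt (h := hlt)).mono fun n hn => hn.le
  refine ⟨τ, hτ, hmono, L, hL, fun ω => tendsto_of_le_liminf_of_limsup_le ?_ ?_⟩
  · exact (hmono ω).tendsto_atTop.liminf_le_liminf_comp
  · have h0 : Tendsto (fun k : ℕ => L ω + ((k : ℝ≥0∞) + 1)⁻¹) atTop (𝓝 (L ω)) := by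
      have : Tendsto (fun k : ℕ => ((k : ℝ≥0∞) + 1)⁻¹) atTop (𝓝 0) := by
        have := (tendsto_add_atTop_iff_nat 1).2 ENNReal.tendsto_inv_nat_nhds_zero
        simpa using this
      simpa using this.const_add (L ω)
    calc _ ≤ limsup (fun k : ℕ => L ω + ((k : ℝ≥0∞) + 1)⁻¹) atTop :=
          limsup_le_limsup (Eventually.of_forall fun k => hmem k ω)
      _ = L ω := h0.limsup_eq

/-- A measurable random subsequence can be refined to one along which finitely many sequences
of `[0, ∞]`-valued random variables converge. -/
theorem exists_measurable_refinement_tendsto {Ω ι : Type*} {mΩ : MeasurableSpace Ω}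
    (ξ : ℕ → ι → Ω → ℝ≥0∞) (hξ : ∀ n i, Measurable (ξ n i)) (τ : ℕ → Ω → ℕ)
    (hτ : ∀ k, Measurable (τ k)) (s : Finset ι) :
    ∃ σ : ℕ → Ω → ℕ, (∀ k, Measurable (σ k)) ∧ (∀ ω, StrictMono fun k => σ k ω) ∧
      ∀ i ∈ s, ∃ L : Ω → ℝ≥0∞, Measurable L ∧
        ∀ ω, Tendsto (fun k => ξ (τ (σ k ω) ω) i ω) atTop (𝓝 (L ω)) := by
  classical
  induction s using Finset.induction with
  | empty => exact ⟨fun k _ => k, fun k => measurable_const, fun ω => strictMono_id, by simp⟩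
  | insert i s _ ih =>
    obtain ⟨σ, hσ, hmono, hconv⟩ := ih
    have hτσ : ∀ k, Measurable fun ω => τ (σ k ω) ω := fun k => .eval_random_index hτ (hσ k)
    obtain ⟨ρ, hρ, hρmono, L, hL, hLconv⟩ := exists_measurable_strictMono_tendsto
      (fun k ω => ξ (τ (σ k ω) ω) i ω)
      fun k => .eval_random_index (fun n => hξ n i) (hτσ k)
    refine ⟨fun k ω => σ (ρ k ω) ω, fun k => .eval_random_index hσ (hρ k),
      fun ω => (hmono ω).comp (hρmono ω), fun i' hi' => ?_⟩
    rcases Finset.mem_insert.1 hi' with rfl | hi'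
    · exact ⟨L, hL, hLconv⟩
    · obtain ⟨L', hL', hconv'⟩ := hconv i' hi'
      exact ⟨L', hL', fun ω => (hconv' ω).comp (hρmono ω).tendsto_atTop⟩

/-- Adapted `[0, ∞]`-valued processes converge, up to a finite horizon, along a random subsequence
to adapted limits. -/
theorem exists_adapted_limit {Ω ι : Type*} [Fintype ι] {m : MeasurableSpace Ω}
    (𝓕 : Filtration ℕ m) (T : ℕ) (ξ : ℕ → ℕ → ι → Ω → ℝ≥0∞)
    (hξ : ∀ n s i, s ≤ T → Measurable[𝓕 s] (ξ n s i)) :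
    ∃ L : ℕ → ι → Ω → ℝ≥0∞, (∀ s i, s ≤ T → Measurable[𝓕 s] (L s i)) ∧
      ∀ ω, ∃ σ : ℕ → ℕ, StrictMono σ ∧
        ∀ s i, s ≤ T → Tendsto (fun k => ξ (σ k) s i ω) atTop (𝓝 (L s i ω)) := by
  -- The indices `τ` use information up to `t`, but further refinement does not change the limits
  -- already obtained for `s ≤ t`. These therefore stay `𝓕 s`-measurable.
  have key : ∀ t, t ≤ T → ∃ τ : ℕ → Ω → ℕ, (∀ k, Measurable[𝓕 t] (τ k)) ∧
      (∀ ω, StrictMono fun k => τ k ω) ∧ ∀ s i, s ≤ t → ∃ L : Ω → ℝ≥0∞, Measurable[𝓕 s] L ∧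
        ∀ ω, Tendsto (fun k => ξ (τ k ω) s i ω) atTop (𝓝 (L ω)) := by
    intro t
    induction t with
    | zero =>
      intro h0
      obtain ⟨σ, hσ, hmono, hconv⟩ := exists_measurable_refinement_tendsto (mΩ := 𝓕 0)
        (fun n => ξ n 0) (fun n i => hξ n 0 i h0) (fun k _ => k) (fun k => measurable_const)
        Finset.univ
      refine ⟨σ, hσ, hmono, fun s i hs => ?_⟩
      obtain rfl : s = 0 := by omega
      exact hconv i (Finset.mem_univ i)
    | succ t ih =>
      intro ht
      obtain ⟨τ, hτ, hτmono, hτconv⟩ := ih (by omega)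
      have hτ' : ∀ k, Measurable[𝓕 (t + 1)] (τ k) := fun k =>
        (hτ k).mono (𝓕.mono t.le_succ) le_rfl
      obtain ⟨σ, hσ, hmono, hconv⟩ := exists_measurable_refinement_tendsto (mΩ := 𝓕 (t + 1))
        (fun n => ξ n (t + 1)) (fun n i => hξ n (t + 1) i ht) τ hτ' Finset.univ
      refine ⟨fun k ω => τ (σ k ω) ω,
        fun k => Measurable.eval_random_index (mΩ := 𝓕 (t + 1)) hτ' (hσ k),
        fun ω => (hτmono ω).comp (hmono ω), fun s i hs => ?_⟩
      rcases Nat.lt_or_ge t s with h | h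
      · obtain rfl : s = t + 1 := by omega
        exact hconv i (Finset.mem_univ i)
      · obtain ⟨L, hL, hLconv⟩ := hτconv s i h
        exact ⟨L, hL, fun ω => (hLconv ω).comp (hmono ω).tendsto_atTop⟩
  obtain ⟨τ, -, hmono, hconv⟩ := key T le_rfl
  choose! L hL hLconv using hconv
  exact ⟨L, fun s i hs => hL s i hs, fun ω => ⟨fun k => τ k ω, hmono ω,
    fun s i hs => hLconv s i hs ω⟩⟩

end RandomSubsequences

/-! ### Long-only trading without taxes -/

section FrictionlessMarket

/-- The gain at time `s + 1` from holding the nonnegative position `φ s` over one period, for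
the price increments `Δ`. -/
noncomputable def longGain {Ω : Type*} {d : ℕ} (Δ : ℕ → Ω → Fin d → ℝ) (φ : ℕ → Ω → Fin d → ℝ≥0)
    (s : ℕ) (ω : Ω) : ℝ :=
  ∑ j, (φ s ω j : ℝ) * Δ (s + 1) ω j

/-- A nonnegative one-period position that never loses money vanishes. -/
def OnePeriodRisky {Ω : Type*} {m : MeasurableSpace Ω} {d : ℕ} (P : Measure Ω)
    (𝓕 : Filtration ℕ m) (T : ℕ) (Δ : ℕ → Ω → Fin d → ℝ) : Prop :=
  ∀ t, t < T → ∀ β : Ω → Fin d → ℝ≥0, Measurable[𝓕 t] β →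
    (∀ᵐ ω ∂P, 0 ≤ ∑ j, (β ω j : ℝ) * Δ (t + 1) ω j) → β =ᵐ[P] 0

variable {Ω : Type*} {m : MeasurableSpace Ω} {d T : ℕ} {P : Measure Ω} {𝓕 : Filtration ℕ m}
  {Δ : ℕ → Ω → Fin d → ℝ}

theorem measurable_longGain (hΔ : ∀ s, s < T → Measurable[𝓕 (s + 1)] (Δ (s + 1)))
    {φ : ℕ → Ω → Fin d → ℝ≥0} {s : ℕ} (hs : s < T) (hφ : Measurable[𝓕 s] (φ s)) :
    Measurable[𝓕 (s + 1)] (longGain Δ φ s) := by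
  have hφ' : Measurable[𝓕 (s + 1)] (φ s) := hφ.mono (𝓕.mono s.le_succ) le_rfl
  have hΔ' := hΔ s hs
  refine Finset.measurable_fun_sum _ fun j _ => Measurable.mul ?_ ?_
  · exact measurable_coe_nnreal_real.comp ((measurable_pi_apply j).comp hφ')
  · exact (measurable_pi_apply j).comp hΔ'

/-- If the wealth at the terminal time is nonnegative, so is the wealth before. -/
theorem OnePeriodRisky.nonneg_of_final_nonneg (hNA : OnePeriodRisky P 𝓕 T Δ)
    (hΔ : ∀ s, s < T → Measurable[𝓕 (s + 1)] (Δ (s + 1)))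
    {φ : ℕ → Ω → Fin d → ℝ≥0} {u : ℕ} (hu : u ≤ T)
    (hφ : ∀ s, u ≤ s → s < T → Measurable[𝓕 s] (φ s)) {w : Ω → ℝ} (hw : Measurable[𝓕 u] w)
    (h : ∀ᵐ ω ∂P, 0 ≤ w ω + ∑ s ∈ Finset.Ico u T, longGain Δ φ s ω) : ∀ᵐ ω ∂P, 0 ≤ w ω := by
  classical
  obtain ⟨k, hk⟩ : ∃ k, u + k = T := ⟨T - u, by omega⟩
  induction k generalizing u w with
  | zero =>
    obtain rfl : u = T := by omega
    simpa using h
  | succ k ih =>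
    have huT : u < T := by omega
    have hφu := hφ u le_rfl huT
    have h1 : ∀ᵐ ω ∂P, 0 ≤ w ω + longGain Δ φ u ω := by
      refine ih (by omega) (fun s hs => hφ s (by omega))
        ((hw.mono (𝓕.mono u.le_succ) le_rfl).add (measurable_longGain hΔ huT hφu)) ?_ (by omega)
      filter_upwards [h] with ω hω
      rwa [Finset.sum_eq_sum_Ico_succ_bot huT, ← add_assoc] at hω
    -- Holding `φ u` only where wealth is negative never loses, since the gain there has to repair
    -- the deficit. So that position vanishes and the deficit cannot be repaired.
    have hA : MeasurableSet[𝓕 u] {ω | w ω < 0} := measurableSet_lt hw measurable_const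
    have hβ := hNA u huT ({ω | w ω < 0}.indicator (φ u)) (hφu.indicator hA) (by
      filter_upwards [h1] with ω hω
      by_cases hwω : w ω < 0
      · have : 0 ≤ longGain Δ φ u ω := by linarith
        simpa [Set.indicator, hwω, longGain] using this
      · simp [Set.indicator, hwω])
    filter_upwards [h1, hβ] with ω hω hβω
    by_contra! hwω
    have hz : φ u ω = 0 := by simpa [Set.indicator, hwω] using hβω
    simp [longGain, hz] at hω
    linarith

/-- Viewed as wealth at time `t + 1`, the first gain must already be nonnegative, so the one-period
condition applies to `φ t`. -/
theorem OnePeriodRisky.eq_zero_of_final_nonneg (hNA : OnePeriodRisky P 𝓕 T Δ)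
    (hΔ : ∀ s, s < T → Measurable[𝓕 (s + 1)] (Δ (s + 1)))
    {φ : ℕ → Ω → Fin d → ℝ≥0} {t : ℕ} (ht : t < T)
    (hφ : ∀ s, t ≤ s → s < T → Measurable[𝓕 s] (φ s))
    (h : ∀ᵐ ω ∂P, 0 ≤ ∑ s ∈ Finset.Ico t T, longGain Δ φ s ω) : φ t =ᵐ[P] 0 := by
  refine hNA t ht (φ t) (hφ t le_rfl ht) (hNA.nonneg_of_final_nonneg hΔ (u := t + 1) ht
    (fun s hs => hφ s (by omega)) (measurable_longGain hΔ ht (hφ t le_rfl ht)) ?_)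
  filter_upwards [h] with ω hω
  rwa [Finset.sum_eq_sum_Ico_succ_bot ht] at hω

/-- Strategies whose terminal gains are bounded from below, pointwise in the state, are bounded,
pointwise in the state. -/
theorem OnePeriodRisky.bddAbove_of_bddBelow (hNA : OnePeriodRisky P 𝓕 T Δ)
    (hΔ : ∀ s, s < T → Measurable[𝓕 (s + 1)] (Δ (s + 1))) {t : ℕ} (ht : t ≤ T)
    (φ : ℕ → ℕ → Ω → Fin d → ℝ≥0) (hφ : ∀ n s, t ≤ s → s < T → Measurable[𝓕 s] (φ n s))
    (h : ∀ᵐ ω ∂P, ∃ c : ℝ, ∀ n, -c ≤ ∑ s ∈ Finset.Ico t T, longGain Δ (φ n) s ω) :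
    ∀ᵐ ω ∂P, ∀ s, t ≤ s → s < T → ∃ C : ℝ≥0, ∀ n j, φ n s ω j ≤ C := by
  classical
  obtain ⟨k, hk⟩ : ∃ k, t + k = T := ⟨T - t, by omega⟩
  induction k generalizing t φ with
  | zero => exact Eventually.of_forall fun ω s hs hs' => by omega
  | succ k ih =>
    have htT : t < T := by omega
    let size : ℕ → Ω → ℝ≥0 := fun n ω => ∑ j, φ n t ω j
    have hsize : ∀ n, Measurable[𝓕 t] (size n) := fun n =>
      Finset.measurable_fun_sum _ fun j _ => (measurable_pi_apply j).comp (hφ n t le_rfl htT)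
    -- The event that the first positions are unbounded along the sequence. It belongs to `𝓕 t`, so
    -- that restricting to it keeps strategies adapted.
    let A : Set Ω := {ω | ∀ k : ℕ, ∃ᶠ n in atTop, (k : ℝ≥0) ≤ size n ω}
    have hEm : ∀ k n : ℕ, MeasurableSet[𝓕 t] {ω | (k : ℝ≥0) ≤ size n ω} := fun k n =>
      measurableSet_le measurable_const (hsize n)
    have hA : MeasurableSet[𝓕 t] A := by
      have : A = ⋂ k : ℕ, ⋂ N : ℕ, ⋃ n : ℕ, ⋃ _ : N ≤ n, {ω | (k : ℝ≥0) ≤ size n ω} := by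
        ext ω; simp [A, frequently_atTop]
      rw [this]
      exact MeasurableSet.iInter fun k => MeasurableSet.iInter fun N =>
        MeasurableSet.iUnion fun n => MeasurableSet.iUnion fun _ => hEm k n
    -- Adding `Aᶜ` makes the events recur in every state. The shift to `k + 1` keeps the later
    -- divisor positive on `A`.
    obtain ⟨τ, hτ, -, hτA⟩ := exists_measurable_strictMono_mem (mΩ := 𝓕 t)
      (fun k n => Aᶜ ∪ {ω | ((k + 1 : ℕ) : ℝ≥0) ≤ size n ω})
      (fun k n => hA.compl.union (hEm (k + 1) n)) fun k ω => by
        by_cases hω : ω ∈ A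
        · exact (hω (k + 1)).mono fun n hn => Or.inr hn
        · exact (Eventually.of_forall fun n => Or.inl hω).frequently
    replace hτA : ∀ k : ℕ, ∀ ω ∈ A, ((k : ℝ≥0) + 1) ≤ size (τ k ω) ω := fun k ω hω => by
      simpa using (hτA k ω).resolve_left (fun h => h hω)
    let ψ : ℕ → ℕ → Ω → Fin d → ℝ≥0 := fun k s =>
      A.indicator fun ω j => φ (τ k ω) s ω j / size (τ k ω) ω
    have hψ : ∀ n s, t ≤ s → s < T → Measurable[𝓕 s] (ψ n s) := by
      intro n s hs hsT
      have hle : 𝓕 t ≤ 𝓕 s := 𝓕.mono hs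
      have hτs : Measurable[𝓕 s] (τ n) := (hτ n).mono hle le_rfl
      refine Measurable.indicator ?_ (hle A hA)
      refine (@measurable_pi_iff _ _ _ (𝓕 s) _ _).2 fun j => Measurable.div ?_ ?_
      · exact Measurable.eval_random_index (mΩ := 𝓕 s) (f := fun n ω => φ n s ω j)
          (fun n => (measurable_pi_apply j).comp (hφ n s hs hsT)) hτs
      · exact Measurable.eval_random_index (mΩ := 𝓕 s)
          (fun n => (hsize n).mono hle le_rfl) hτs
    have hψt : ∀ k, ∀ ω ∈ A, ∑ j, ψ k t ω j = 1 := by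
      intro k ω hω
      have hpos : 0 < size (τ k ω) ω := lt_of_lt_of_le (by positivity) (hτA k ω hω)
      simp only [ψ, Set.indicator_of_mem hω, ← Finset.sum_div]
      exact div_self hpos.ne'
    have hψle : ∀ k ω j, ψ k t ω j ≤ 1 := by
      intro k ω j
      by_cases hω : ω ∈ A
      · rw [← hψt k ω hω]
        exact Finset.single_le_sum (f := fun j => ψ k t ω j) (fun _ _ => zero_le)
          (Finset.mem_univ j)
      · simp [ψ, hω]
    have hgain : ∀ᵐ ω ∂P, ∃ c : ℝ, 0 ≤ c ∧ ∀ k : ℕ,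
        -(c / (k + 1)) ≤ ∑ s ∈ Finset.Ico t T, longGain Δ (ψ k) s ω := by
      filter_upwards [h] with ω ⟨c, hc⟩
      refine ⟨max c 0, le_max_right _ _, fun k => ?_⟩
      by_cases hω : ω ∈ A
      · have hq := hτA k ω hω
        have hq' : (k : ℝ) + 1 ≤ size (τ k ω) ω := by exact_mod_cast hq
        have hk0 : (0 : ℝ) < k + 1 := by positivity
        have heq : ∑ s ∈ Finset.Ico t T, longGain Δ (ψ k) s ω
            = (∑ s ∈ Finset.Ico t T, longGain Δ (φ (τ k ω)) s ω) / size (τ k ω) ω := by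
          rw [Finset.sum_div]
          refine Finset.sum_congr rfl fun s _ => ?_
          simp only [longGain, ψ, Set.indicator_of_mem hω, NNReal.coe_div, Finset.sum_div]
          exact Finset.sum_congr rfl fun j _ => by ring
        rw [heq, ← neg_div]
        calc -max c 0 / (k + 1) ≤ -max c 0 / size (τ k ω) ω := by
              rw [neg_div, neg_div, neg_le_neg_iff]
              exact div_le_div_of_nonneg_left (le_max_right _ _) hk0 hq'
          _ ≤ _ := by
              refine div_le_div_of_nonneg_right ?_ (hk0.le.trans hq')
              exact (neg_le_neg (le_max_left _ _)).trans (hc _)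
      · have : ∀ s, longGain Δ (ψ k) s ω = 0 := fun s => by simp [longGain, ψ, hω]
        simp only [this, Finset.sum_const_zero, neg_nonpos]
        positivity
    -- The first normalized position is at most one, so its gain can be absorbed into the lower
    -- bound; the induction hypothesis handles the later dates.
    have hψbdd : ∀ᵐ ω ∂P, ∀ s, t ≤ s → s < T → ∃ C : ℝ≥0, ∀ n j, ψ n s ω j ≤ C := by
      have := ih (t := t + 1) htT ψ (fun n s hs => hψ n s (by omega)) (by
        filter_upwards [hgain] with ω ⟨c, hc0, hc⟩
        refine ⟨c + ∑ j, |Δ (t + 1) ω j|, fun k => ?_⟩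
        have h1 := hc k
        rw [Finset.sum_eq_sum_Ico_succ_bot htT] at h1
        have h2 : longGain Δ (ψ k) t ω ≤ ∑ j, |Δ (t + 1) ω j| := by
          refine Finset.sum_le_sum fun j _ => ?_
          have : (ψ k t ω j : ℝ) ≤ 1 := by exact_mod_cast hψle k ω j
          calc (ψ k t ω j : ℝ) * Δ (t + 1) ω j ≤ ψ k t ω j * |Δ (t + 1) ω j| :=
                mul_le_mul_of_nonneg_left (le_abs_self _) (NNReal.coe_nonneg _)
            _ ≤ 1 * |Δ (t + 1) ω j| := mul_le_mul_of_nonneg_right this (abs_nonneg _)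
            _ = _ := one_mul _
        have h3 : c / (k + 1) ≤ c := div_le_self hc0 (by simp)
        linarith) (by omega)
      filter_upwards [this] with ω hω s hs hsT
      rcases hs.eq_or_lt with rfl | hs
      · exact ⟨1, fun n j => hψle n ω j⟩
      · exact hω s hs hsT
    obtain ⟨L, hL, hconv⟩ := exists_adapted_limit 𝓕 T
      (fun n s j ω => if t ≤ s ∧ s < T then (ψ n s ω j : ℝ≥0∞) else 0) (fun n s j _ => by
        by_cases hs : t ≤ s ∧ s < T
        · simp only [hs, and_self, if_true]
          exact measurable_coe_nnreal_ennreal.comp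
            ((measurable_pi_apply j).comp (hψ n s hs.1 hs.2))
        · simp only [hs, if_false]
          exact measurable_const)
    let Ψ : ℕ → Ω → Fin d → ℝ≥0 := fun s ω j => (L s j ω).toNNReal
    have hΨ : ∀ s, s < T → Measurable[𝓕 s] (Ψ s) := fun s hs =>
      (@measurable_pi_iff _ _ _ (𝓕 s) _ _).2 fun j => ENNReal.measurable_toNNReal.comp (hL s j hs.le)
    have hconv' : ∀ᵐ ω ∂P, ∃ σ : ℕ → ℕ, StrictMono σ ∧ ∀ s, t ≤ s → s < T → ∀ j,
        Tendsto (fun k => ψ (σ k) s ω j) atTop (𝓝 (Ψ s ω j)) := by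
      filter_upwards [hψbdd] with ω hω
      obtain ⟨σ, hσ, hlim⟩ := hconv ω
      refine ⟨σ, hσ, fun s hs hsT j => ?_⟩
      obtain ⟨C, hC⟩ := hω s hs hsT
      have hl := hlim s j hsT.le
      simp only [hs, hsT, and_self, if_true] at hl
      have hfin : L s j ω ≠ ∞ := ne_top_of_le_ne_top ENNReal.coe_ne_top
        (le_of_tendsto' hl fun k => ENNReal.coe_le_coe.2 (hC (σ k) j))
      simpa [Function.comp_def] using (ENNReal.tendsto_toNNReal hfin).comp hl
    -- The lower bounds `-c/(k+1)` vanish in the limit, so the limit strategy never loses. Yet on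
    -- `A` its first position has total size one, whence `A` is null.
    have hΨt : Ψ t =ᵐ[P] 0 := by
      refine hNA.eq_zero_of_final_nonneg hΔ htT (fun s _ hs => hΨ s hs) ?_
      filter_upwards [hconv', hgain] with ω ⟨σ, hσ, hlim⟩ ⟨c, hc0, hc⟩
      have hlhs : Tendsto (fun k : ℕ => -(c / ((σ k : ℕ) + 1 : ℝ))) atTop (𝓝 0) := by
        have h1 : Tendsto (fun k : ℕ => c / ((k : ℝ) + 1)) atTop (𝓝 0) :=
          tendsto_const_nhds.div_atTop
            (tendsto_atTop_add_const_right _ _ tendsto_natCast_atTop_atTop)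
        simpa using (h1.comp hσ.tendsto_atTop).neg
      refine le_of_tendsto_of_tendsto' hlhs (tendsto_finsetSum _ fun s hs => ?_)
        fun k => hc (σ k)
      rw [Finset.mem_Ico] at hs
      exact tendsto_finsetSum _ fun j _ =>
        ((NNReal.tendsto_coe.2 (hlim s hs.1 hs.2 j)).mul_const _)
    have hAnull : ∀ᵐ ω ∂P, ω ∉ A := by
      filter_upwards [hconv', hΨt] with ω ⟨σ, hσ, hlim⟩ hz hω
      have h1 : Tendsto (fun k => ∑ j, ψ (σ k) t ω j) atTop (𝓝 (∑ j, Ψ t ω j)) :=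
        tendsto_finsetSum _ fun j _ => hlim t le_rfl htT j
      simp only [hψt _ ω hω, hz, Pi.zero_apply, Finset.sum_const_zero] at h1
      exact one_ne_zero (tendsto_nhds_unique tendsto_const_nhds h1)
    have hbt : ∀ᵐ ω ∂P, ∃ C : ℝ≥0, ∀ n j, φ n t ω j ≤ C := by
      filter_upwards [hAnull] with ω hω
      simp only [A, Set.mem_ofPred_eq, not_forall, not_frequently, not_le] at hω
      obtain ⟨k, hk⟩ := hω
      obtain ⟨C, hC⟩ := (isBoundedUnder_of_eventually_le
        (hk.mono fun n hn => hn.le)).bddAbove_range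
      refine ⟨C, fun n j => le_trans ?_ (hC ⟨n, rfl⟩)⟩
      exact Finset.single_le_sum (f := fun j => φ n t ω j) (fun _ _ => zero_le)
        (Finset.mem_univ j)
    -- With the first positions bounded, their gains move into the state-dependent constant, leaving
    -- a problem with one period fewer.
    have hrest := ih (t := t + 1) htT φ (fun n s hs => hφ n s (by omega)) (by
      filter_upwards [h, hbt] with ω ⟨c, hc⟩ ⟨C, hC⟩
      refine ⟨c + ∑ j, C * |Δ (t + 1) ω j|, fun n => ?_⟩
      have h1 := hc n
      rw [Finset.sum_eq_sum_Ico_succ_bot htT] at h1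
      have h2 : longGain Δ (φ n) t ω ≤ ∑ j, C * |Δ (t + 1) ω j| := by
        refine Finset.sum_le_sum fun j _ => ?_
        have : (φ n t ω j : ℝ) ≤ C := by exact_mod_cast hC n j
        exact (mul_le_mul_of_nonneg_left (le_abs_self _) (NNReal.coe_nonneg _)).trans
          (mul_le_mul_of_nonneg_right this (abs_nonneg _))
      linarith) (by omega)
    filter_upwards [hbt, hrest] with ω h1 h2 s hs hsT
    rcases hs.eq_or_lt with rfl | hs
    · exact h1
    · exact h2 s hs hsT

end FrictionlessMarket

/-! ### Boundedness in L⁰ of long positions -/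

section LongPositions

/-- The random variables that are dominated by the total position of a strategy with terminal
gains bounded from below by `-c`. -/
def dominatedByLongPositions {Ω : Type*} {m : MeasurableSpace Ω} {d : ℕ} (P : Measure Ω)
    (𝓕 : Filtration ℕ m) (T : ℕ) (Δ : ℕ → Ω → Fin d → ℝ) (c : ℝ) : Set (Ω → ℝ) :=
  {X | ∃ φ : ℕ → Ω → Fin d → ℝ≥0, (∀ s, s < T → Measurable[𝓕 s] (φ s)) ∧
    (∀ᵐ ω ∂P, -c ≤ ∑ s ∈ Finset.Ico 0 T, longGain Δ φ s ω) ∧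
    ∀ᵐ ω ∂P, |X ω| ≤ ∑ s ∈ Finset.range T, ∑ j, (φ s ω j : ℝ)}

variable {Ω : Type*} {m : MeasurableSpace Ω} {d T : ℕ} {P : Measure Ω} {𝓕 : Filtration ℕ m}
  {Δ : ℕ → Ω → Fin d → ℝ}

/-- Gains are linear in the positions, so mixing strategies keeps the bound `-c`; domination instead
of equality absorbs the triangle inequality. -/
theorem convex_dominatedByLongPositions (c : ℝ) :
    Convex ℝ (dominatedByLongPositions P 𝓕 T Δ c) := by
  rintro X ⟨φ, hφ, hφc, hφX⟩ Y ⟨ψ, hψ, hψc, hψY⟩ a b ha hb hab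
  lift a to ℝ≥0 using ha
  lift b to ℝ≥0 using hb
  refine ⟨fun s ω j => a * φ s ω j + b * ψ s ω j, fun s hs => ?_, ?_, ?_⟩
  · refine (@measurable_pi_iff _ _ _ (𝓕 s) _ _).2 fun j => Measurable.add ?_ ?_
    · exact ((measurable_pi_apply j).comp (hφ s hs)).const_mul a
    · exact ((measurable_pi_apply j).comp (hψ s hs)).const_mul b
  · filter_upwards [hφc, hψc] with ω h1 h2
    have : ∑ s ∈ Finset.Ico 0 T, longGain Δ (fun s ω j => a * φ s ω j + b * ψ s ω j) s ω
        = a * ∑ s ∈ Finset.Ico 0 T, longGain Δ φ s ω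
          + b * ∑ s ∈ Finset.Ico 0 T, longGain Δ ψ s ω := by
      simp only [longGain, Finset.mul_sum, ← Finset.sum_add_distrib]
      refine Finset.sum_congr rfl fun s _ => Finset.sum_congr rfl fun j _ => ?_
      push_cast
      ring
    rw [this]
    calc -c = a * -c + b * -c := by rw [← add_mul, hab, one_mul]
      _ ≤ _ := by gcongr
  · filter_upwards [hφX, hψY] with ω h1 h2
    calc |((a : ℝ) • X + (b : ℝ) • Y) ω| ≤ |(a : ℝ) * X ω| + |(b : ℝ) * Y ω| := by
          simpa using abs_add_le ((a : ℝ) * X ω) (b * Y ω)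
      _ = a * |X ω| + b * |Y ω| := by simp [abs_mul]
      _ ≤ a * (∑ s ∈ Finset.range T, ∑ j, (φ s ω j : ℝ))
          + b * ∑ s ∈ Finset.range T, ∑ j, (ψ s ω j : ℝ) := by gcongr
      _ = _ := by simp [Finset.mul_sum, ← Finset.sum_add_distrib]

/-- Failure yields, for one fixed `ε`, strategies whose total positions exceed `n` with probability
above `ε` for every `n`. This contradicts boundedness of the sequence state by state. -/
theorem OnePeriodRisky.boundedInL0 [IsFiniteMeasure P] (hNA : OnePeriodRisky P 𝓕 T Δ)
    (hΔ : ∀ s, s < T → Measurable[𝓕 (s + 1)] (Δ (s + 1))) (c : ℝ) :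
    BoundedInL0 P (dominatedByLongPositions P 𝓕 T Δ c) := by
  by_contra hcon
  rw [BoundedInL0, ENNReal.tendsto_nhds_zero] at hcon
  push Not at hcon
  obtain ⟨ε, hε, hfreq⟩ := hcon
  have hX : ∀ n : ℕ, ∃ φ : ℕ → Ω → Fin d → ℝ≥0, (∀ s, s < T → Measurable[𝓕 s] (φ s)) ∧
      (∀ᵐ ω ∂P, -c ≤ ∑ s ∈ Finset.Ico 0 T, longGain Δ φ s ω) ∧
      ε < P {ω | (n : ℝ) < ∑ s ∈ Finset.range T, ∑ j, (φ s ω j : ℝ)} := by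
    intro n
    obtain ⟨a, ha, hlt⟩ := frequently_atTop.1 hfreq n
    simp only [lt_iSup_iff] at hlt
    obtain ⟨X, ⟨φ, hφ, hφc, hφX⟩, hlt⟩ := hlt
    refine ⟨φ, hφ, hφc, hlt.trans_le (measure_mono_ae ?_)⟩
    filter_upwards [hφX] with ω hω hlt
    exact (ha.trans_lt hlt).trans_le hω
  choose φ hφ hφc hφε using hX
  have hbdd := hNA.bddAbove_of_bddBelow hΔ (Nat.zero_le T) φ (fun n s _ hs => hφ n s hs) (by
    filter_upwards [ae_all_iff.2 hφc] with ω hω using ⟨c, hω⟩)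
  let tot : ℕ → Ω → ℝ := fun n ω => ∑ s ∈ Finset.range T, ∑ j, (φ n s ω j : ℝ)
  have htot : ∀ n, Measurable (tot n) := fun n =>
    Finset.measurable_fun_sum _ fun s hs => Finset.measurable_fun_sum _ fun j _ =>
      measurable_coe_nnreal_real.comp ((measurable_pi_apply j).comp
        ((hφ n s (Finset.mem_range.1 hs)).mono (𝓕.le s) le_rfl))
  -- Events that some total position exceeds `n`. They decrease to a null set, though each has
  -- probability above `ε`.
  let U : ℕ → Set Ω := fun n => ⋃ k, {ω | (n : ℝ) < tot k ω}
  have hU : Tendsto (fun n => P (U n)) atTop (𝓝 (P (⋂ n, U n))) := by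
    refine tendsto_measure_iInter_atTop (fun n => (MeasurableSet.iUnion fun k =>
      measurableSet_lt measurable_const (htot k)).nullMeasurableSet) ?_ ⟨0, measure_ne_top _ _⟩
    intro n n' hn
    refine Set.iUnion_mono fun k ω (hω : (n' : ℝ) < tot k ω) => ?_
    exact (Nat.cast_le.2 hn).trans_lt hω
  have hnull : P (⋂ n, U n) = 0 := by
    refine measure_eq_zero_iff_ae_notMem.2 ?_
    filter_upwards [hbdd] with ω hω hmem
    have hex : ∀ s, ∃ C : ℝ≥0, s < T → ∀ n j, φ n s ω j ≤ C := fun s => by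
      by_cases hs : s < T
      · obtain ⟨C, hC⟩ := hω s (Nat.zero_le s) hs
        exact ⟨C, fun _ => hC⟩
      · exact ⟨0, fun h => absurd h hs⟩
    choose C hC using hex
    obtain ⟨n, hn⟩ := exists_nat_gt (∑ s ∈ Finset.range T, ∑ _j : Fin d, (C s : ℝ))
    obtain ⟨k, hk⟩ := Set.mem_iUnion.1 (Set.mem_iInter.1 hmem n)
    refine absurd (hn.trans hk) (not_lt.2 ?_)
    exact Finset.sum_le_sum fun s hs => Finset.sum_le_sum fun j _ => by
      exact_mod_cast hC s (Finset.mem_range.1 hs) k j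
  rw [hnull] at hU
  obtain ⟨n, hn⟩ := (hU.eventually_lt_const hε).exists
  exact absurd hn (not_lt.2 ((hφε n).le.trans
    (measure_mono (Set.subset_iUnion (fun k => {ω | (n : ℝ) < tot k ω}) n))))

end LongPositions

/-! ### Comparison with the untaxed market; regularity of the account -/

namespace TaxMarket

variable {Ω : Type*} [m : MeasurableSpace Ω] {P : Measure Ω} {d T : ℕ} (M : TaxMarket Ω P d T)

/-- The number of shares held after trading at time `t`. -/
noncomputable def position (N : Holdings Ω d) (t : ℕ) (ω : Ω) (j : Fin d) : ℝ≥0 :=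
  ∑ i ∈ Finset.range (t + 1), N i t ω j

/-- The value of one unit of money invested in the bank account at time `0`, before taxes. -/
noncomputable def compounding (t : ℕ) (ω : Ω) : ℝ := ∏ u ∈ Finset.range t, (1 + |M.r (u + 1) ω|)

/-- The discounted excess returns of the stocks over the bank account, before taxes. -/
noncomputable def excessReturn (t : ℕ) (ω : Ω) (j : Fin d) : ℝ :=
  (M.S t ω j - (1 + M.r t ω) * M.S (t - 1) ω j) / M.compounding t ω

/-- The absolute values make this hold in every state, although rates are nonnegative only almost
surely. -/
theorem one_le_compounding (t : ℕ) (ω : Ω) : 1 ≤ M.compounding t ω :=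
  Finset.one_le_prod (fun _ _ => by simp)

theorem compounding_succ (t : ℕ) (ω : Ω) :
    M.compounding (t + 1) ω = M.compounding t ω * (1 + |M.r (t + 1) ω|) :=
  Finset.prod_range_succ _ _

theorem measurable_price {s t : ℕ} (hst : s ≤ t) (ht : t ≤ T) (j : Fin d) :
    Measurable[M.𝓕 t] fun ω => M.S s ω j :=
  (measurable_pi_apply j).comp ((M.measurable_S s (hst.trans ht)).mono (M.𝓕.mono hst) le_rfl)

theorem measurable_compounding {t : ℕ} (ht : t ≤ T) : Measurable[M.𝓕 t] (M.compounding t) := by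
  refine Finset.measurable_fun_prod _ fun u hu => ?_
  have hu' : u + 1 ≤ t := Finset.mem_range.1 hu
  have h : Measurable[M.𝓕 t] (M.r (u + 1)) :=
    (M.measurable_r (u + 1) (by omega) (hu'.trans ht)).mono (M.𝓕.mono hu') le_rfl
  exact (measurable_norm.comp h).const_add 1

theorem measurable_excessReturn {s : ℕ} (hs : s < T) :
    Measurable[M.𝓕 (s + 1)] (M.excessReturn (s + 1)) := by
  refine (@measurable_pi_iff _ _ _ (M.𝓕 (s + 1)) _ _).2 fun j => Measurable.div (Measurable.sub
    (M.measurable_price le_rfl hs j) (Measurable.mul ?_ (M.measurable_price s.le_succ hs j)))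
    (M.measurable_compounding hs)
  exact (M.measurable_r (s + 1) (by omega) hs).const_add 1

theorem ae_interest_nonneg : ∀ᵐ ω ∂P, ∀ t, t < T → 0 ≤ M.r (t + 1) ω := by
  refine ae_all_iff.2 fun t => ?_
  by_cases ht : t < T
  · filter_upwards [M.r_nonneg (t + 1) (by omega) ht] with ω hω _ using hω
  · exact Eventually.of_forall fun ω h => absurd h ht

theorem account_succ (x : ℝ) (N : Holdings Ω d) (t : ℕ) (ω : Ω) :
    M.account x N (t + 1) ω =
      ((M.account x N t ω).1 + M.r (t + 1) ω * (M.account x N t ω).1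
          + M.tradingCashFlow N (t + 1) ω
          - (M.α * max (M.account x N t ω).2.2 ((M.account x N t ω).2.1
              + ((M.account x N t ω).1 * M.r (t + 1) ω + M.realizedStockGain N (t + 1) ω))
            - M.α * (M.account x N t ω).2.2),
        (M.account x N t ω).2.1
          + ((M.account x N t ω).1 * M.r (t + 1) ω + M.realizedStockGain N (t + 1) ω),
        max (M.account x N t ω).2.2 ((M.account x N t ω).2.1
          + ((M.account x N t ω).1 * M.r (t + 1) ω + M.realizedStockGain N (t + 1) ω))) := rfl

/-- Taxes only reduce the wealth: the after-tax wealth is dominated by the wealth that the same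
positions generate in the market without taxes. -/
theorem wealth_le (x : ℝ) (N : Holdings Ω d) {ω : Ω} (hr : ∀ t, t < T → 0 ≤ M.r (t + 1) ω)
    {t : ℕ} (ht : t ≤ T) :
    (M.account x N t ω).1 + ∑ j, (position N t ω j : ℝ) * M.S t ω j ≤
      M.compounding t ω *
        (x + ∑ s ∈ Finset.range t, longGain M.excessReturn (position N) s ω) := by
  induction t with
  | zero => simp [account, tradingCashFlow, position, compounding]
  | succ t ih =>
    have hr' := hr t ht
    have hB : 0 < M.compounding (t + 1) ω := one_pos.trans_le (M.one_le_compounding _ ω)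
    have hcash : M.tradingCashFlow N (t + 1) ω
        = ∑ j, ((position N t ω j : ℝ) - position N (t + 1) ω j) * M.S (t + 1) ω j := by
      refine Finset.sum_congr rfl fun j _ => ?_
      simp only [position, NNReal.coe_sum]
      rw [Finset.sum_range_succ _ (t + 1), Finset.sum_sub_distrib, Nat.add_sub_cancel]
      ring
    have hgain : M.compounding (t + 1) ω * longGain M.excessReturn (position N) t ω
        = ∑ j, (position N t ω j : ℝ) *
          (M.S (t + 1) ω j - (1 + M.r (t + 1) ω) * M.S t ω j) := by
      simp only [longGain, Finset.mul_sum, excessReturn, Nat.add_sub_cancel]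
      refine Finset.sum_congr rfl fun j _ => ?_
      field_simp
    have htax : M.α * (M.account x N t ω).2.2 ≤ M.α * max (M.account x N t ω).2.2
        ((M.account x N t ω).2.1
          + ((M.account x N t ω).1 * M.r (t + 1) ω + M.realizedStockGain N (t + 1) ω)) :=
      mul_le_mul_of_nonneg_left (le_max_left _ _) M.α_nonneg
    have hih := mul_le_mul_of_nonneg_right (ih (by omega)) (by linarith : 0 ≤ 1 + M.r (t + 1) ω)
    rw [Finset.sum_range_succ, ← add_assoc, mul_add _ (x + _), hgain, M.compounding_succ,
      abs_of_nonneg hr', account_succ]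
    have h1 : ∑ j, ((position N t ω j : ℝ) - position N (t + 1) ω j) * M.S (t + 1) ω j
        + ∑ j, (position N (t + 1) ω j : ℝ) * M.S (t + 1) ω j
        = (∑ j, (position N t ω j : ℝ) * M.S t ω j) * (1 + M.r (t + 1) ω)
          + ∑ j, (position N t ω j : ℝ) *
            (M.S (t + 1) ω j - (1 + M.r (t + 1) ω) * M.S t ω j) := by
      rw [Finset.sum_mul, ← Finset.sum_add_distrib, ← Finset.sum_add_distrib]
      exact Finset.sum_congr rfl fun j _ => by ring
    rw [hcash]
    dsimp only
    linarith

variable {M}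

theorem ae_monotone_of_mem_strategies {N : Holdings Ω d} (hN : N ∈ M.strategies) :
    ∀ᵐ ω ∂P, (∀ i s t, i ≤ s → s ≤ t → t ≤ T → ∀ j, N i t ω j ≤ N i s ω j) ∧
      ∀ i, i ≤ T → ∀ j, N i T ω j = 0 := by
  obtain ⟨-, hmono, hT⟩ := hN
  have h1 : ∀ᵐ ω ∂P, ∀ i t, i ≤ t → t < T → ∀ j, N i (t + 1) ω j ≤ N i t ω j := by
    refine ae_all_iff.2 fun i => ae_all_iff.2 fun t => ?_
    by_cases h : i ≤ t ∧ t < T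
    · filter_upwards [hmono i t h.1 h.2] with ω hω _ _ using hω
    · exact Eventually.of_forall fun ω h1 h2 => absurd ⟨h1, h2⟩ h
  have h2 : ∀ᵐ ω ∂P, ∀ i, i ≤ T → ∀ j, N i T ω j = 0 := by
    refine ae_all_iff.2 fun i => ?_
    by_cases h : i ≤ T
    · filter_upwards [hT i h] with ω hω _ using hω
    · exact Eventually.of_forall fun ω h1 => absurd h1 h
  filter_upwards [h1, h2] with ω hω1 hω2
  refine ⟨fun i s t his hst => ?_, hω2⟩
  induction t, hst using Nat.le_induction with
  | base => exact fun _ j => le_rfl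
  | succ t hst ih => exact fun ht j => (hω1 i t (his.trans hst) ht j).trans (ih (by omega) j)

theorem measurable_holding {N : Holdings Ω d} (hN : N ∈ M.strategies) {i s t : ℕ} (his : i ≤ s)
    (hst : s ≤ t) (ht : t ≤ T) (j : Fin d) : Measurable[M.𝓕 t] fun ω => (N i s ω j : ℝ) :=
  measurable_coe_nnreal_real.comp ((measurable_pi_apply j).comp
    ((hN.1 i s his (hst.trans ht)).mono (M.𝓕.mono hst) le_rfl))

theorem measurable_position {N : Holdings Ω d} (hN : N ∈ M.strategies) {t : ℕ} (ht : t ≤ T) :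
    Measurable[M.𝓕 t] (position N t) :=
  (@measurable_pi_iff _ _ _ (M.𝓕 t) _ _).2 fun j => Finset.measurable_fun_sum _ fun i hi =>
    (measurable_pi_apply j).comp (hN.1 i t (Nat.lt_succ_iff.1 (Finset.mem_range.1 hi)) ht)

/-- After liquidation, `wealth_le` bounds terminal wealth by the compounding factor times `x` plus
gains. The factor is at least one, so discounting only shrinks a loss and rates need no upper bound.
Since `c` is quantified inside the almost-sure statement, it may depend on the state. -/
theorem longGain_ge_of_terminalWealth_ge (x : ℝ) {N : Holdings Ω d} (hN : N ∈ M.strategies) :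
    ∀ᵐ ω ∂P, ∀ c : ℝ, 0 ≤ c → -c ≤ M.terminalWealth x N ω →
      -(c + |x|) ≤ ∑ s ∈ Finset.Ico 0 T, longGain M.excessReturn (position N) s ω := by
  filter_upwards [M.ae_interest_nonneg, ae_monotone_of_mem_strategies hN] with ω hr hω c hc hV
  have h := M.wealth_le x N hr le_rfl
  have hpos : ∀ j, position N T ω j = 0 := fun j =>
    Finset.sum_eq_zero fun i hi => hω.2 i (Nat.lt_succ_iff.1 (Finset.mem_range.1 hi)) j
  simp only [hpos, NNReal.coe_zero, zero_mul, Finset.sum_const_zero, add_zero] at h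
  have hB := M.one_le_compounding T ω
  rw [← Finset.range_eq_Ico]
  set g := ∑ s ∈ Finset.range T, longGain M.excessReturn (position N) s ω
  by_contra! hcon
  have hxg : x + g < -c := by linarith [le_abs_self x]
  have : -c ≤ M.compounding T ω * (x + g) := hV.trans h
  nlinarith [mul_le_mul_of_nonpos_right hB (by linarith : x + g ≤ 0)]

/-- The account of a strategy depends continuously on the holdings, state by state. -/
theorem tendsto_account (x : ℝ) {N : ℕ → Holdings Ω d} {N' : Holdings Ω d} {ω : Ω} {t : ℕ}
    (h : ∀ i s j, i ≤ s → s ≤ t → Tendsto (fun k => N k i s ω j) atTop (𝓝 (N' i s ω j))) :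
    Tendsto (fun k => M.account x (N k) t ω) atTop (𝓝 (M.account x N' t ω)) := by
  have hcoe : ∀ i s j, i ≤ s → s ≤ t →
      Tendsto (fun k => (N k i s ω j : ℝ)) atTop (𝓝 (N' i s ω j : ℝ)) :=
    fun i s j his hst => NNReal.tendsto_coe.2 (h i s j his hst)
  have hdiff : ∀ i s j, i < s → s ≤ t → Tendsto
      (fun k => (N k i (s - 1) ω j : ℝ) - N k i s ω j) atTop
      (𝓝 ((N' i (s - 1) ω j : ℝ) - N' i s ω j)) :=
    fun i s j his hst => (hcoe i (s - 1) j (by omega) (by omega)).sub (hcoe i s j his.le hst)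
  have hcash : ∀ s, s ≤ t → Tendsto (fun k => M.tradingCashFlow (N k) s ω) atTop
      (𝓝 (M.tradingCashFlow N' s ω)) := fun s hs =>
    tendsto_finsetSum _ fun j _ => ((tendsto_finsetSum _ fun i hi =>
      hdiff i s j (Finset.mem_range.1 hi) hs).sub (hcoe s s j le_rfl hs)).mul_const _
  have hreal : ∀ s, s ≤ t → Tendsto (fun k => M.realizedStockGain (N k) s ω) atTop
      (𝓝 (M.realizedStockGain N' s ω)) := fun s hs =>
    tendsto_finsetSum _ fun i hi => tendsto_finsetSum _ fun j _ =>
      (hdiff i s j (Finset.mem_range.1 hi) hs).mul_const _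
  clear h hcoe hdiff
  induction t with
  | zero => exact ((hcash 0 le_rfl).const_add x).prodMk_nhds tendsto_const_nhds
  | succ t ih =>
    have hprev := ih (fun s hs => hcash s (by omega)) (fun s hs => hreal s (by omega))
    have hη := hprev.fst_nhds
    have hG' := hprev.snd_nhds.fst_nhds.add ((hη.mul_const (M.r (t + 1) ω)).add
      (hreal (t + 1) le_rfl))
    have hmx := hprev.snd_nhds.snd_nhds
    have hmx' := hmx.max hG'
    exact (((hη.add (hη.const_mul _)).add (hcash (t + 1) le_rfl)).sub
      ((hmx'.const_mul _).sub (hmx.const_mul _))).prodMk_nhds (hG'.prodMk_nhds hmx')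

theorem terminalWealth_congr (x : ℝ) {N N' : Holdings Ω d} {ω : Ω}
    (h : ∀ i s j, i ≤ s → s ≤ T → N i s ω j = N' i s ω j) :
    M.terminalWealth x N ω = M.terminalWealth x N' ω := by
  -- A constant sequence converges to both accounts, so uniqueness of limits identifies them.
  have := tendsto_account (M := M) x (N := fun _ => N) (N' := N') (ω := ω) (t := T)
    fun i s j his hs => by rw [h i s j his hs]; exact tendsto_const_nhds
  exact congrArg Prod.fst (tendsto_nhds_unique tendsto_const_nhds this)

theorem measurable_account (x : ℝ) {N : Holdings Ω d} (hN : N ∈ M.strategies) {t : ℕ}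
    (ht : t ≤ T) : Measurable[M.𝓕 t] (M.account x N t) := by
  have hdiff : ∀ i s j, i < s → s ≤ T → Measurable[M.𝓕 s]
      fun ω => (N i (s - 1) ω j : ℝ) - N i s ω j := fun i s j his hs =>
    (measurable_holding hN (by omega) (by omega) hs j).sub
      (measurable_holding hN his.le le_rfl hs j)
  have hcash : ∀ s, s ≤ T → Measurable[M.𝓕 s] (M.tradingCashFlow N s) := fun s hs =>
    Finset.measurable_fun_sum _ fun j _ => ((Finset.measurable_fun_sum _ fun i hi =>
      hdiff i s j (Finset.mem_range.1 hi) hs).sub (measurable_holding hN le_rfl le_rfl hs j)).mul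
        (M.measurable_price le_rfl hs j)
  have hreal : ∀ s, s ≤ T → Measurable[M.𝓕 s] (M.realizedStockGain N s) := fun s hs =>
    Finset.measurable_fun_sum _ fun i hi => Finset.measurable_fun_sum _ fun j _ =>
      (hdiff i s j (Finset.mem_range.1 hi) hs).mul ((M.measurable_price le_rfl hs j).sub
        (M.measurable_price (Finset.mem_range.1 hi).le hs j))
  induction t with
  | zero => exact ((hcash 0 ht).const_add x).prodMk measurable_const
  | succ t ih =>
    have hprev : Measurable[M.𝓕 (t + 1)] (M.account x N t) :=
      (ih (by omega)).mono (M.𝓕.mono t.le_succ) le_rfl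
    have hr := M.measurable_r (t + 1) (by omega) ht
    have hη := measurable_fst.comp hprev
    have hG' := (measurable_fst.comp (measurable_snd.comp hprev)).add
      ((hη.mul hr).add (hreal (t + 1) ht))
    have hmx := measurable_snd.comp (measurable_snd.comp hprev)
    have hmx' := hmx.max hG'
    exact (((hη.add (hr.mul hη)).add (hcash (t + 1) ht)).sub
      ((hmx'.const_mul _).sub (hmx.const_mul _))).prodMk (hG'.prodMk hmx')

end TaxMarket

theorem Holdings.maxPurchase_le {Ω : Type*} {d T : ℕ} {N N' : Holdings Ω d} {ω : Ω}
    (h : ∀ i t j, i ≤ t → t ≤ T → N i t ω j = N' i t ω j) :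
    |N.maxPurchase T ω| ≤ ∑ s ∈ Finset.range T, ∑ j, (TaxMarket.position N' s ω j : ℝ) := by
  have : (Finset.univ.sup fun p : Fin T × Fin d => N p.1 p.1 ω p.2) ≤
      ∑ s ∈ Finset.range T, ∑ j, TaxMarket.position N' s ω j := by
    refine Finset.sup_le fun p _ => ?_
    rw [h p.1 p.1 p.2 le_rfl p.1.2.le]
    calc N' p.1 p.1 ω p.2 ≤ TaxMarket.position N' p.1 ω p.2 :=
          Finset.single_le_sum (f := fun i => N' i p.1 ω p.2) (fun _ _ => zero_le)
            (Finset.self_mem_range_succ _)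
      _ ≤ ∑ j, TaxMarket.position N' p.1 ω j :=
          Finset.single_le_sum (f := fun j => TaxMarket.position N' p.1 ω j) (fun _ _ => zero_le)
            (Finset.mem_univ _)
      _ ≤ _ := Finset.single_le_sum (f := fun s => ∑ j, TaxMarket.position N' s ω j)
            (fun _ _ => zero_le) (Finset.mem_range.2 p.1.2)
  rw [Holdings.maxPurchase, abs_of_nonneg (NNReal.coe_nonneg _)]
  exact_mod_cast this

/-! ### One-period investments under taxes -/

namespace TaxMarket

variable {Ω : Type*} [m : MeasurableSpace Ω] {P : Measure Ω} {d T : ℕ} (M : TaxMarket Ω P d T)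

/-- The strategy that buys `β` at time `t` and sells everything at time `t + 1`. -/
def buyAndSell (t : ℕ) (β : Ω → Fin d → ℝ≥0) : Holdings Ω d :=
  fun i s => if i = t ∧ s = t then β else 0

theorem buyAndSell_mem_strategies {t : ℕ} (ht : t < T) {β : Ω → Fin d → ℝ≥0}
    (hβ : Measurable[M.𝓕 t] β) : buyAndSell t β ∈ M.strategies := by
  refine ⟨fun i s _ _ => ?_, fun i s _ _ => ?_, fun i _ => ?_⟩
  · by_cases h : i = t ∧ s = t
    · obtain ⟨rfl, rfl⟩ := h
      simpa [buyAndSell] using hβ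
    · simp only [buyAndSell, h, if_false]
      exact measurable_const
  · refine Eventually.of_forall fun ω j => ?_
    have : ¬ (i = t ∧ s + 1 = t) := by omega
    simp [buyAndSell, this]
  · refine Eventually.of_forall fun ω j => ?_
    have : ¬ (i = t ∧ T = t) := by omega
    simp [buyAndSell, this]

theorem tradingCashFlow_buyAndSell (t : ℕ) (β : Ω → Fin d → ℝ≥0) (s : ℕ) (ω : Ω) :
    M.tradingCashFlow (buyAndSell t β) s ω =
      if s = t then -∑ j, (β ω j : ℝ) * M.S t ω j
      else if s = t + 1 then ∑ j, (β ω j : ℝ) * M.S (t + 1) ω j else 0 := by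
  rcases eq_or_ne s t with rfl | hst
  · rw [if_pos rfl, ← Finset.sum_neg_distrib]
    refine Finset.sum_congr rfl fun j _ => ?_
    rw [Finset.sum_eq_zero]
    · simp [buyAndSell]
    · intro i hi
      have : i ≠ s := (Finset.mem_range.1 hi).ne
      simp [buyAndSell, this]
  rw [if_neg hst]
  split_ifs with hs
  · subst hs
    refine Finset.sum_congr rfl fun j _ => ?_
    rw [Finset.sum_eq_single t]
    · simp [buyAndSell]
    · intro i _ hi
      simp [buyAndSell, hi]
    · simp
  · refine Finset.sum_eq_zero fun j _ => ?_
    rw [Finset.sum_eq_zero]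
    · simp [buyAndSell, hst]
    · intro i hi
      have : ¬ (i = t ∧ s - 1 = t) := by have := Finset.mem_range.1 hi; omega
      simp [buyAndSell, this, hst]

theorem realizedStockGain_buyAndSell (t : ℕ) (β : Ω → Fin d → ℝ≥0) (s : ℕ) (ω : Ω) :
    M.realizedStockGain (buyAndSell t β) s ω =
      if s = t + 1 then ∑ j, (β ω j : ℝ) * (M.S (t + 1) ω j - M.S t ω j) else 0 := by
  split_ifs with hs
  · subst hs
    rw [realizedStockGain, Finset.sum_eq_single t]
    · simp [buyAndSell]
    · intro i _ hi
      simp [buyAndSell, hi]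
    · simp
  · refine Finset.sum_eq_zero fun i hi => Finset.sum_eq_zero fun j _ => ?_
    have := Finset.mem_range.1 hi
    have h1 : ¬ (i = t ∧ s - 1 = t) := by omega
    have h2 : ¬ (i = t ∧ s = t) := by omega
    simp [buyAndSell, h1, h2]

theorem account_buyAndSell_before {t s : ℕ} (hst : s < t) (β : Ω → Fin d → ℝ≥0) (ω : Ω) :
    M.account 0 (buyAndSell t β) s ω = (0, 0, 0) := by
  induction s with
  | zero => simp [account, tradingCashFlow_buyAndSell, hst.ne]
  | succ s ih =>
    rw [account_succ, ih (by omega), tradingCashFlow_buyAndSell, realizedStockGain_buyAndSell,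
      if_neg hst.ne, if_neg (by omega), if_neg (by omega)]
    simp

theorem account_buyAndSell_purchase (t : ℕ) (β : Ω → Fin d → ℝ≥0) (ω : Ω) :
    M.account 0 (buyAndSell t β) t ω = (-∑ j, (β ω j : ℝ) * M.S t ω j, 0, 0) := by
  cases t with
  | zero => simp [account, tradingCashFlow_buyAndSell]
  | succ t =>
    rw [account_succ, account_buyAndSell_before M t.lt_succ_self, tradingCashFlow_buyAndSell,
      realizedStockGain_buyAndSell, if_pos rfl, if_neg (by omega)]
    simp

/-- A one-period investment without losses leads to a nonnegative terminal wealth that is at least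
the after-tax gain: the proceeds are invested in the bank account. -/
theorem terminalWealth_buyAndSell_ge {t : ℕ} (ht : t < T) (β : Ω → Fin d → ℝ≥0) {ω : Ω}
    (hr : ∀ t, t < T → 0 ≤ M.r (t + 1) ω)
    (hY : 0 ≤ ∑ j, (β ω j : ℝ) * (M.S (t + 1) ω j - (1 + M.r (t + 1) ω) * M.S t ω j)) :
    (1 - M.α) * ∑ j, (β ω j : ℝ) * (M.S (t + 1) ω j - (1 + M.r (t + 1) ω) * M.S t ω j) ≤
      M.terminalWealth 0 (buyAndSell t β) ω := by
  set Y := ∑ j, (β ω j : ℝ) * (M.S (t + 1) ω j - (1 + M.r (t + 1) ω) * M.S t ω j) with hYdef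
  have hα : 0 ≤ 1 - M.α := sub_nonneg.2 M.α_lt_one.le
  -- Interest on the money financing the purchase enters the taxable gain, so this gain and the
  -- pre-tax cash both equal `Y`, and the tax is `α Y`.
  have hgain : -(∑ j, (β ω j : ℝ) * M.S t ω j) * M.r (t + 1) ω
      + ∑ j, (β ω j : ℝ) * (M.S (t + 1) ω j - M.S t ω j) = Y := by
    rw [hYdef, neg_mul, Finset.sum_mul, ← Finset.sum_neg_distrib, ← Finset.sum_add_distrib]
    exact Finset.sum_congr rfl fun j _ => by ring
  have hcash : -(∑ j, (β ω j : ℝ) * M.S t ω j)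
      + M.r (t + 1) ω * -(∑ j, (β ω j : ℝ) * M.S t ω j)
      + ∑ j, (β ω j : ℝ) * M.S (t + 1) ω j = Y := by
    rw [hYdef, mul_neg, Finset.mul_sum, ← Finset.sum_neg_distrib, ← Finset.sum_neg_distrib,
      ← Finset.sum_add_distrib, ← Finset.sum_add_distrib]
    exact Finset.sum_congr rfl fun j _ => by ring
  -- After the sale only interest on a nonnegative account accrues. Accumulated gains stay at their
  -- running maximum, and interest taxed at a rate below one cannot reduce the account.
  have key : ∀ s, t + 1 ≤ s → s ≤ T →
      (1 - M.α) * Y ≤ (M.account 0 (buyAndSell t β) s ω).1 ∧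
      (M.account 0 (buyAndSell t β) s ω).2.2 = (M.account 0 (buyAndSell t β) s ω).2.1 := by
    intro s hs
    induction s, hs using Nat.le_induction with
    | base =>
      intro _
      rw [account_succ, account_buyAndSell_purchase, tradingCashFlow_buyAndSell,
        realizedStockGain_buyAndSell, if_neg (by omega), if_pos rfl, if_pos rfl]
      dsimp only
      rw [hgain, hcash, zero_add, max_eq_right hY]
      exact ⟨by linarith, rfl⟩
    | succ s hs ih =>
      intro hsT
      obtain ⟨h1, h2⟩ := ih (by omega)
      have hr' := hr s hsT
      have hη := (mul_nonneg hα hY).trans h1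
      rw [account_succ, tradingCashFlow_buyAndSell, realizedStockGain_buyAndSell,
        if_neg (by omega), if_neg (by omega), if_neg (by omega)]
      dsimp only
      rw [h2]
      have hG : (M.account 0 (buyAndSell t β) s ω).2.1 ≤ (M.account 0 (buyAndSell t β) s ω).2.1
          + ((M.account 0 (buyAndSell t β) s ω).1 * M.r (s + 1) ω + 0) := by
        have := mul_nonneg hη hr'
        linarith
      rw [max_eq_right hG]
      refine ⟨?_, rfl⟩
      have := mul_nonneg hα (mul_nonneg hη hr')
      linarith
  exact (key T ht le_rfl).1

variable {M}

/-- Buying `β` on credit and selling it one period later keeps at least `1 - α` times its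
nonnegative gain, so NA makes the gain zero and `β` reversible. -/
theorem onePeriodRisky_excessReturn (hNA : M.NoArbitrage) (hR : M.NoRedundantStocks) :
    OnePeriodRisky P M.𝓕 T M.excessReturn := by
  intro t ht β hβ hpos
  refine hR t ht β ⟨hβ, ?_⟩
  have hY : ∀ᵐ ω ∂P, 0 ≤ ∑ j, (β ω j : ℝ) *
      (M.S (t + 1) ω j - (1 + M.r (t + 1) ω) * M.S t ω j) := by
    filter_upwards [hpos] with ω hω
    have hB := one_pos.trans_le (M.one_le_compounding (t + 1) ω)
    have : ∑ j, (β ω j : ℝ) * M.excessReturn (t + 1) ω j = (∑ j, (β ω j : ℝ) *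
        (M.S (t + 1) ω j - (1 + M.r (t + 1) ω) * M.S t ω j)) / M.compounding (t + 1) ω := by
      rw [Finset.sum_div]
      exact Finset.sum_congr rfl fun j _ => (mul_div_assoc _ _ _).symm
    rwa [this, le_div_iff₀ hB, zero_mul] at hω
  have hα : 0 < 1 - M.α := sub_pos.2 M.α_lt_one
  have hge : ∀ᵐ ω ∂P, (1 - M.α) * ∑ j, (β ω j : ℝ) *
      (M.S (t + 1) ω j - (1 + M.r (t + 1) ω) * M.S t ω j) ≤
        M.terminalWealth 0 (buyAndSell t β) ω := by
    filter_upwards [hY, M.ae_interest_nonneg] with ω hω hr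
      using M.terminalWealth_buyAndSell_ge ht β hr hω
  have hzero := hNA _ (M.buyAndSell_mem_strategies ht hβ) (by
    filter_upwards [hY, hge] with ω h1 h2 using (mul_nonneg hα.le h1).trans h2)
  filter_upwards [hY, hge, hzero] with ω h1 h2 h3
  rw [h3] at h2
  exact le_antisymm (nonpos_of_mul_nonpos_right h2 hα) h1

/-! ### The identity reaction, limit strategies and closedness -/

variable (M)

/-- The reaction function that plays the running minimum of the actions; it reacts to a strategy
with the strategy itself. -/
noncomputable def runningMinReaction : M.ReactionFunction where
  -- Monotonicity is demanded at every input, including ones that no strategy produces, so the bare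
  -- coordinates would not do.
  toFun p k := ⨅ s : {s : Fin T // k.1.1.1 ≤ s ∧ s ≤ k.1.1.2}, p.2 (⟨(k.1.1.1, s), s.2.1⟩, k.2)
  measurable_toFun k := by
    refine Measurable.iInf fun s => ?_
    rw [measurable_iff_comap_le, BorelSpace.measurable_eq (α := ℝ≥0)]
    refine le_sup_of_le_right (le_iSup₂_of_le (⟨(k.1.1.1, s), s.2.1⟩, k.2) ?_ le_rfl)
    exact s.2.2
  antitone_toFun p i t s j hit hts := by
    have : Nonempty {u : Fin T // i ≤ u ∧ u ≤ t} := ⟨⟨i, le_rfl, hit⟩⟩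
    refine le_ciInf fun u => ?_
    exact ciInf_le (OrderBot.bddBelow _)
      (⟨u, u.2.1, u.2.2.trans hts⟩ : {u : Fin T // i ≤ u ∧ u ≤ s})

variable {M}

theorem runningMinReaction_apply {N : Holdings Ω d} (hN : N ∈ M.strategies) :
    ∀ᵐ ω ∂P, ∀ i t j, i ≤ t → t ≤ T → M.runningMinReaction.apply N i t ω j = N i t ω j := by
  filter_upwards [ae_monotone_of_mem_strategies hN] with ω hω i t j hit htT
  rcases htT.eq_or_lt with rfl | htT
  · simp [ReactionFunction.apply, hω.2 i hit j]
  · rw [ReactionFunction.apply, dif_pos ⟨hit, htT⟩]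
    have : Nonempty {u : Fin T // ⟨i, hit.trans_lt htT⟩ ≤ u ∧ u ≤ ⟨t, htT⟩} :=
      ⟨⟨⟨t, htT⟩, hit, le_rfl⟩⟩
    refine le_antisymm ?_ (le_ciInf fun u => hω.1 i u t u.2.1 u.2.2 htT.le j)
    exact ciInf_le (OrderBot.bddBelow _)
      (⟨⟨t, htT⟩, hit, le_rfl⟩ : {u : Fin T // ⟨i, hit.trans_lt htT⟩ ≤ u ∧ u ≤ ⟨t, htT⟩})

theorem runningMinReaction_isIdentity : M.runningMinReaction.IsIdentity := by
  intro N hN i t hit ht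
  filter_upwards [runningMinReaction_apply hN] with ω hω
  exact funext fun j => hω i t j hit ht

theorem isNUIBRReaction_runningMinReaction [IsProbabilityMeasure P] (hNA : M.NoArbitrage)
    (hR : M.NoRedundantStocks) (x : ℝ) : M.IsNUIBRReaction x M.runningMinReaction := by
  refine ⟨fun N hN => ?_, fun K hK => ?_⟩
  · filter_upwards [runningMinReaction_apply hN] with ω hω
    exact (terminalWealth_congr x fun i s j his hs => (hω i s j his hs).symm).le
  · refine tendsto_of_tendsto_of_tendsto_of_le_of_le tendsto_const_nhds
      ((onePeriodRisky_excessReturn hNA hR).boundedInL0 (fun s hs => M.measurable_excessReturn hs)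
        (K + |x|)) (fun _ => zero_le) fun a => ?_
    -- The hull lies in a convex set already known to be bounded, so only the generators need
    -- checking.
    refine biSup_mono (convexHull_min ?_ (convex_dominatedByLongPositions _))
    rintro X ⟨N, hN, hV, rfl⟩
    refine ⟨position N, fun s hs => measurable_position hN hs.le, ?_, ?_⟩
    · filter_upwards [longGain_ge_of_terminalWealth_ge x hN, hV] with ω h1 h2 using h1 K hK h2
    · filter_upwards [runningMinReaction_apply hN] with ω hω using Holdings.maxPurchase_le hω

/-- A sequence of strategies with terminal wealths bounded from below, state by state, has a
limit strategy along random subsequences. -/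
theorem exists_limit_strategy (hNA : M.NoArbitrage) (hR : M.NoRedundantStocks) (x : ℝ)
    {N : ℕ → Holdings Ω d} (hN : ∀ n, N n ∈ M.strategies)
    (hV : ∀ᵐ ω ∂P, ∃ c : ℝ, ∀ n, -c ≤ M.terminalWealth x (N n) ω) :
    ∃ N' ∈ M.strategies, ∀ᵐ ω ∂P, ∃ σ : ℕ → ℕ, StrictMono σ ∧
      Tendsto (fun k => M.terminalWealth x (N (σ k)) ω) atTop (𝓝 (M.terminalWealth x N' ω)) := by
  have hbdd := (onePeriodRisky_excessReturn hNA hR).bddAbove_of_bddBelow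
    (fun s hs => M.measurable_excessReturn hs) (Nat.zero_le T) (fun n => position (N n))
    (fun n s _ hs => measurable_position (hN n) hs.le) (by
      filter_upwards [hV, ae_all_iff.2 fun n => longGain_ge_of_terminalWealth_ge x (hN n)]
        with ω ⟨c, hc⟩ h
      refine ⟨max c 0 + |x|, fun n => h n _ (le_max_right _ _) ?_⟩
      exact (neg_le_neg (le_max_left _ _)).trans (hc n))
  obtain ⟨L, hL, hconv⟩ := exists_adapted_limit M.𝓕 T
    (ι := Fin (T + 1) × Fin d)
    (fun n s p ω => if (p.1 : ℕ) ≤ s then (N n p.1 s ω p.2 : ℝ≥0∞) else 0) (fun n s p hs => by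
      by_cases h : (p.1 : ℕ) ≤ s
      · simp only [h, if_true]
        exact measurable_coe_nnreal_ennreal.comp
          ((measurable_pi_apply _).comp ((hN n).1 p.1 s h hs))
      · simp only [h, if_false]
        exact measurable_const)
  -- `Fin.ofNat` reduces modulo `T + 1`, which changes only the irrelevant entries with `i > T`.
  let N' : Holdings Ω d := fun i s ω j => (L s (Fin.ofNat (T + 1) i, j) ω).toNNReal
  have hlim : ∀ᵐ ω ∂P, ∃ σ : ℕ → ℕ, StrictMono σ ∧ ∀ i s j, i ≤ s → s ≤ T →
      Tendsto (fun k => N (σ k) i s ω j) atTop (𝓝 (N' i s ω j)) := by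
    filter_upwards [hbdd, ae_all_iff.2 fun n => ae_monotone_of_mem_strategies (hN n)]
      with ω hω hmono
    obtain ⟨σ, hσ, hlim⟩ := hconv ω
    refine ⟨σ, hσ, fun i s j his hs => ?_⟩
    have hi : ((Fin.ofNat (T + 1) i : Fin (T + 1)) : ℕ) = i :=
      Nat.mod_eq_of_lt (by omega)
    have hl := hlim s (Fin.ofNat (T + 1) i, j) hs
    simp only [hi, his, if_true] at hl
    obtain ⟨C, hC⟩ : ∃ C : ℝ≥0, ∀ n, N n i s ω j ≤ C := by
      rcases hs.eq_or_lt with rfl | hsT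
      · exact ⟨0, fun n => ((hmono n).2 i his j).le⟩
      · obtain ⟨C, hC⟩ := hω s (Nat.zero_le s) hsT
        refine ⟨C, fun n => le_trans ?_ (hC n j)⟩
        exact Finset.single_le_sum (f := fun i => N n i s ω j) (fun _ _ => zero_le)
          (Finset.mem_range.2 (Nat.lt_succ_iff.2 his))
    have hfin : L s (Fin.ofNat (T + 1) i, j) ω ≠ ∞ := ne_top_of_le_ne_top ENNReal.coe_ne_top
      (le_of_tendsto' hl fun k => ENNReal.coe_le_coe.2 (hC (σ k)))
    simpa [Function.comp_def, N'] using (ENNReal.tendsto_toNNReal hfin).comp hl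
  refine ⟨N', ⟨fun i t hit ht => ?_, fun i t hit ht => ?_, fun i hi => ?_⟩, ?_⟩
  · exact (@measurable_pi_iff _ _ _ (M.𝓕 t) _ _).2 fun j =>
      ENNReal.measurable_toNNReal.comp (hL t _ ht)
  · filter_upwards [hlim, ae_all_iff.2 fun n => ae_monotone_of_mem_strategies (hN n)]
      with ω ⟨σ, _, hσ⟩ hmono j
    exact le_of_tendsto_of_tendsto' (hσ i (t + 1) j (by omega) ht) (hσ i t j hit ht.le)
      fun k => (hmono (σ k)).1 i t (t + 1) hit t.le_succ ht j
  · filter_upwards [hlim, ae_all_iff.2 fun n => ae_monotone_of_mem_strategies (hN n)]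
      with ω ⟨σ, _, hσ⟩ hmono j
    refine tendsto_nhds_unique (hσ i T j hi le_rfl) ?_
    simp only [fun k => (hmono (σ k)).2 i hi j, tendsto_const_nhds]
  · filter_upwards [hlim] with ω ⟨σ, hσmono, hσ⟩
    exact ⟨σ, hσmono, (tendsto_account x hσ).fst_nhds⟩

/-- Almost sure convergence along a subsequence bounds the terminal wealths below state by state,
though not uniformly. The limit strategy's wealth then dominates `f`, and the surplus is thrown
away. -/
theorem closedInProbability_attainable (hNA : M.NoArbitrage) (hR : M.NoRedundantStocks) (x : ℝ) :
    ClosedInProbability P (M.attainable x) := by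
  intro X f hX hXf
  obtain ⟨ns, -, hae⟩ := hXf.exists_seq_tendsto_ae
  choose N hN μ hμ hXeq using hX
  have hVm : ∀ {N : Holdings Ω d}, N ∈ M.strategies → Measurable[M.𝓕 T] (M.terminalWealth x N) :=
    fun hN => measurable_fst.comp (measurable_account x hN le_rfl)
  let g : ℕ → Ω → ℝ := fun n ω => M.terminalWealth x (N (ns n)) ω - μ (ns n) ω
  have hg : ∀ n, Measurable[M.𝓕 T] (g n) := fun n =>
    (hVm (hN _)).sub (measurable_coe_nnreal_real.comp (hμ _))
  have hgf : ∀ᵐ ω ∂P, Tendsto (fun n => g n ω) atTop (𝓝 (f ω)) := by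
    filter_upwards [hae, ae_all_iff.2 hXeq] with ω h1 h2
    simpa only [h2] using h1
  obtain ⟨N', hN', hlim⟩ := exists_limit_strategy hNA hR x (fun n => hN (ns n)) (by
    filter_upwards [hgf] with ω hω
    obtain ⟨c, hc⟩ := hω.bddBelow_range
    refine ⟨-c, fun n => ?_⟩
    have h1 : c ≤ g n ω := hc ⟨n, rfl⟩
    have h2 : (0 : ℝ) ≤ μ (ns n) ω := NNReal.coe_nonneg _
    simp only [g] at h1
    linarith)
  -- The limsup replaces `f`, which need not be `𝓕 T`-measurable itself.
  refine ⟨N', hN', fun ω =>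
    (M.terminalWealth x N' ω - limsup (fun n => g n ω) atTop).toNNReal, ?_, ?_⟩
  · exact measurable_real_toNNReal.comp ((hVm hN').sub (Measurable.limsup hg))
  · filter_upwards [hgf, hlim] with ω h1 ⟨σ, hσ, h2⟩
    have hle : f ω ≤ M.terminalWealth x N' ω :=
      le_of_tendsto_of_tendsto' (h1.comp hσ.tendsto_atTop) h2 fun k =>
        sub_le_self _ (NNReal.coe_nonneg _)
    rw [h1.limsup_eq, Real.coe_toNNReal _ (sub_nonneg.2 hle)]
    ring

end TaxMarket

theorem mainTheorem7 {Ω : Type*} [MeasurableSpace Ω] (P : Measure Ω) [IsProbabilityMeasure P]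
    (d T : ℕ) (M : TaxMarket Ω P d T) (hNA : M.NoArbitrage) (hR : M.NoRedundantStocks) :
    (∃ R : M.ReactionFunction, R.IsIdentity ∧ ∀ x : ℝ, M.IsNUIBRReaction x R) ∧
    M.NUIBR ∧
    ∀ x : ℝ, ClosedInProbability P (M.attainable x) :=
  have hreact := TaxMarket.isNUIBRReaction_runningMinReaction hNA hR
  ⟨⟨M.runningMinReaction, TaxMarket.runningMinReaction_isIdentity, hreact⟩,
    fun x => ⟨M.runningMinReaction, hreact x⟩,
    TaxMarket.closedInProbability_attainable hNA hR⟩
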